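/- **Setting.** An instance of the bipartite matching problem with predictions (BMP$^+$) consists of agents $L=[n]$, resources $R=[m]$, values $v_{ij}>0$ for all $(i,j)\in L\times R$, a predicted matching $\hat M\subseteq L\times R$, and a set $D\subseteq L\times R$ of declared compatible edges, where agent $i$ declares $D_i=\{(i,j)\in D\}$. A matching is a set of edges no two of which share an agent or a resource, and a matching $M$ is feasible if $M\subseteq D$. Put $v(M)=\sum_{(i,j)\in M}v_{ij}$, let $M^*_D$ be a feasible matching of maximum value, and let the prediction error be $\eta=1-v(\hat M\cap D)/v(M^*_D)$ (with $\eta=0$ if $D=\emptyset$). A deterministic mechanism maps every instance to a feasible matching; a randomized mechanism is a probability distribution over a finite set of deterministic mechanisms. Each agent $i$ has a private set $E_i\subseteq\{i\}\times R$ of truly compatible edges, and utility $u_i=v_{ij}$ if the mechanism returns an edge $(i,j)\in E_i$ of agent $i$, and $u_i=0$ otherwise. A deterministic mechanism is group-strategyproof if for all values, predictions, sets $E$ and $D$, every nonempty $S\subseteq L$ and all declarations $D'_S$ of the agents in $S$, some $i\in S$ satisfies $u_i(E_S,D_{-S})\ge u_i(D'_S,D_{-S})$; it is strategyproof if this holds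 for all singletons $S$. A randomized mechanism is universally group-strategyproof if all deterministic mechanisms in its support are group-strategyproof. A mechanism with (expected) value $\mathbb E[v(M)]$ is $\beta$-robust, where $\beta\ge1$, if $\beta\,\mathbb E[v(M)]\ge v(M^*_D)$ on every instance; it is $\alpha$-consistent, where $\alpha\ge 1$, if $\alpha\,\mathbb E[v(M)]\ge v(M^*_D)$ on every instance with $v(\hat M\cap D)=v(M^*_D)$; and it has approximation guarantee $g\ge1$ for prediction error at most $\hat\eta$ if $g\,\mathbb E[v(M)]\ge v(M^*_D)$ on every instance with $\eta\le\hat\eta$. **The mechanisms.** $\textsc{Trust}$ returns $\hat M\cap D$. $\textsc{Boost}$ with parameter $\gamma\ge1$ starts with the empty tentative matching. While some agent is not tentatively matched and has a declared edge through which it has not yet proposed, any such agent $i$ is chosen (by an arbitrary fixed selection rule) and proposes through its remaining declared edge $(i,j)$ of largest value $v_{ij}$; its offer is $\theta_{ij}=\gamma v_{ij}$ if $(i,j)\in\hat M$ and $\theta_{ij}=v_{ij}$ otherwise. If $j$ is unmatched or $i$'s offer beats the offer of $j$'s tentative mate, then $j$ drops that mate (if any) and is tentatively matched to $i$. The final tentative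 matching is returned. Ties of an agent between resources, and of a resource between agents, are broken by arbitrary strict rules that do not depend on the declarations. For $\gamma\ge1$ let $\delta(\gamma)=\sqrt{2(\gamma+1)}-1$ and $p=2/(\delta(\gamma)+1)=2/\sqrt{2(\gamma+1)}$. $\textsc{Boost-or-Trust}$ with parameter $\gamma$ runs $\textsc{Boost}$ with parameter $\delta(\gamma)$ with probability $p$, and $\textsc{Trust}$ with probability $1-p$. **Theorem.** Let $\gamma\ge1$. For all tie-breaking and selection rules, $\textsc{Boost-or-Trust}$ is universally group-strategyproof, and for every $\hat\eta\in[0,1]$ it has, for prediction error at most $\hat\eta$, the expected approximation guarantee $$g(\hat\eta,\gamma)=\begin{cases}\dfrac{1+\gamma}{\gamma(1-\hat\eta)} & \text{if }\hat\eta\le 1-\dfrac{\sqrt{2(\gamma+1)}}{2\gamma},\\[1.5ex] \sqrt{2(\gamma+1)} & \text{otherwise.}\end{cases}$$ In particular, it is $(1+1/\gamma)$-consistent and $\sqrt{2(\gamma+1)}$-robust, both in expectation. In contrast, if $\gamma>1$, then no deterministic strategyproof mechanism for BMP$^+$ is both $(1+1/\gamma)$-consistent and $\sqrt{2(\gamma+1)}$-robust.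 -/

import Mathlib

namespace BMP

noncomputable section

/-- A set of edges between `n` agents and `m` resources. -/
abbrev Edges (n m : ℕ) : Type := Finset (Fin n × Fin m)

/-- No two distinct edges share an agent or a resource. -/
def IsMatching {n m : ℕ} (M : Edges n m) : Prop :=
  ∀ e ∈ M, ∀ f ∈ M, (e.1 = f.1 ∨ e.2 = f.2) → e = f

/-- The part of an instance of the bipartite matching problem with predictions that cannot be
influenced by the agents: positive values and a predicted matching in the complete graph.
A full instance is such a `P` together with a set `D` of declared compatible edges. -/
structure PublicData (n m : ℕ) where
  v : Fin n → Fin m → ℝ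
  v_pos : ∀ i j, 0 < v i j
  pred : Edges n m
  pred_matching : IsMatching pred

/-- Feasible for the compatibility graph with edge set `D`: a matching contained in `D`
(all sizes and capacities are one). -/
def IsFeasible {n m : ℕ} (D M : Edges n m) : Prop := M ⊆ D ∧ IsMatching M

variable {n m : ℕ}

/-- The value `v(M)` of a set of edges. -/
def PublicData.value (P : PublicData n m) (M : Edges n m) : ℝ := ∑ e ∈ M, P.v e.1 e.2

open Classical in
/-- The (finitely many) feasible matchings for `D`. -/
def feasibleSet (D : Edges n m) : Finset (Edges n m) := {M ∈ D.powerset | IsMatching M}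

theorem mem_feasibleSet {D M : Edges n m} : M ∈ feasibleSet D ↔ IsFeasible D M := by
  simp [feasibleSet, IsFeasible]

theorem feasibleSet_nonempty (D : Edges n m) : (feasibleSet D).Nonempty :=
  ⟨∅, mem_feasibleSet.2 ⟨by simp, by simp [IsMatching]⟩⟩

/-- The value `v(M*_D)` of a feasible matching of maximum value. -/
def PublicData.opt (P : PublicData n m) (D : Edges n m) : ℝ :=
  (feasibleSet D).sup' (feasibleSet_nonempty D) P.value

/-- The prediction is perfect for the declarations `D`. -/
def PublicData.IsPerfect (P : PublicData n m) (D : Edges n m) : Prop :=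
  P.value (P.pred ∩ D) = P.opt D

open Classical in
/-- The prediction error `1 - v(pred ∩ D) / v(M*_D)`. If `v(M*_D) = 0` (which happens only for
`D = ∅`, where every prediction is perfect) the error is `0`. -/
def PublicData.error (P : PublicData n m) (D : Edges n m) : ℝ :=
  if P.opt D = 0 then 0 else 1 - P.value (P.pred ∩ D) / P.opt D

/-- A deterministic mechanism maps every instance to a matching that is feasible for the declared
compatibilities. -/
structure DetMechanism where
  out : ∀ {n m : ℕ}, PublicData n m → Edges n m → Edges n m
  feasible : ∀ {n m : ℕ} (P : PublicData n m) (D : Edges n m), IsFeasible D (out P D)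

/-- The utility of agent `i` with true compatibilities `E` if the mechanism returns `M`:
it is `v i j` if `(i, j) ∈ M ∩ E` (for matchings `M` there is at most one such `j`),
and `0` if there is no such `j`. -/
def PublicData.utility (P : PublicData n m) (E M : Edges n m) (i : Fin n) : ℝ :=
  P.value {e ∈ M ∩ E | e.1 = i}

/-- The joint declaration `(A_S, B_{-S})`: the agents in `S` declare as in `A`, all others
as in `B`. -/
def joint (S : Finset (Fin n)) (A B : Edges n m) : Edges n m :=
  {e ∈ A | e.1 ∈ S} ∪ {e ∈ B | e.1 ∉ S}

/-- Here `E` is the private graph, `D` are the declarations, `D'` the deviations. -/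
def DetMechanism.IsStrategyproof (B : DetMechanism) : Prop :=
  ∀ (n m : ℕ) (P : PublicData n m) (E D D' : Edges n m) (i : Fin n),
    P.utility E (B.out P (joint {i} D' D)) i ≤ P.utility E (B.out P (joint {i} E D)) i

/-- No nonempty group of agents has a joint deviation from truthful declarations that makes each
of its members strictly better off. -/
def DetMechanism.IsGroupStrategyproof (B : DetMechanism) : Prop :=
  ∀ (n m : ℕ) (P : PublicData n m) (E D D' : Edges n m) (S : Finset (Fin n)), S.Nonempty →
    ∃ i ∈ S, P.utility E (B.out P (joint S D' D)) i ≤ P.utility E (B.out P (joint S E D)) i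

/-- A randomized mechanism: a probability distribution on a finite set (the support) of
deterministic mechanisms. -/
structure RandMechanism where
  prob : DetMechanism →₀ ℝ
  prob_nonneg : ∀ B, 0 ≤ prob B
  prob_sum : (prob.sum fun _ q => q) = 1

/-- Every deterministic mechanism in the support is group-strategyproof. -/
def RandMechanism.IsUniversallyGroupStrategyproof (R : RandMechanism) : Prop :=
  ∀ B ∈ R.prob.support, B.IsGroupStrategyproof

/-- The value that a mechanism obtains on each instance. -/
abbrev Performance : Type := ∀ n m : ℕ, PublicData n m → Edges n m → ℝ

/-- The value of the matching returned by a deterministic mechanism. -/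
def DetMechanism.performance (B : DetMechanism) : Performance := fun _ _ P D => P.value (B.out P D)

/-- The expected value of the matching returned by a randomized mechanism. -/
def RandMechanism.performance (R : RandMechanism) : Performance :=
  fun _ _ P D => R.prob.sum fun B q => q * P.value (B.out P D)

def IsConsistent (α : ℝ) (val : Performance) : Prop :=
  1 ≤ α ∧ ∀ (n m : ℕ) (P : PublicData n m) (D : Edges n m),
    P.IsPerfect D → P.opt D ≤ α * val n m P D

def IsRobust (β : ℝ) (val : Performance) : Prop :=
  1 ≤ β ∧ ∀ (n m : ℕ) (P : PublicData n m) (D : Edges n m), P.opt D ≤ β * val n m P D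

/-- Approximation guarantee `g` on the class of instances of prediction error at most `ηhat`. -/
def IsApproximate (ηhat g : ℝ) (val : Performance) : Prop :=
  1 ≤ g ∧ ∀ (n m : ℕ) (P : PublicData n m) (D : Edges n m),
    P.error D ≤ ηhat → P.opt D ≤ g * val n m P D

/-! ### The mechanism that follows the prediction -/

/-- Return the declared part of the predicted matching. -/
def trust : DetMechanism where
  out P D := P.pred ∩ D
  feasible P _ := ⟨Finset.inter_subset_right, fun e he f hf =>
    P.pred_matching e (Finset.mem_inter.1 he).1 f (Finset.mem_inter.1 hf).1⟩

/-! ### The boosted deferred acceptance mechanism -/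

/-- Tie-breaking rules of the agents and of the resources; larger rank is preferred. -/
structure TieBreak (n m : ℕ) where
  agent : Fin n → Equiv.Perm (Fin m)
  resource : Fin m → Equiv.Perm (Fin n)

/-- Tie-breaking rules for all instances. They may depend on the public data, but not on the
declarations of the agents. -/
abbrev TieBreakRule : Type := ∀ n m : ℕ, PublicData n m → TieBreak n m

/-- The offer `θ_{ij}(γ, pred)`: the value, boosted by the factor `γ` on predicted edges. -/
def PublicData.offer (P : PublicData n m) (γ : ℝ) (i : Fin n) (j : Fin m) : ℝ :=
  if (i, j) ∈ P.pred then γ * P.v i j else P.v i j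

/-- Agent `i` compares resources by value, then by the tie-breaking rule. -/
def agentKey (P : PublicData n m) (τ : TieBreak n m) (i : Fin n) (j : Fin m) : ℝ ×ₗ Fin m :=
  toLex (P.v i j, τ.agent i j)

/-- Resource `j` compares agents by offer, then by the tie-breaking rule. -/
def resourceKey (P : PublicData n m) (γ : ℝ) (τ : TieBreak n m) (j : Fin m) (i : Fin n) :
    ℝ ×ₗ Fin n :=
  toLex (P.offer γ i j, τ.resource j i)

/-- State of the algorithm: the tentative matching and the edges `(i, j)` through which agent `i`
has not proposed yet. -/
structure State (n m : ℕ) where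
  M : Edges n m
  rem : Edges n m

/-- The active agents: not tentatively matched, and with some remaining proposal. -/
def State.active (s : State n m) : Finset (Fin n) :=
  {i | (∀ j, (i, j) ∉ s.M) ∧ ∃ j, (i, j) ∈ s.rem}

/-- The resources to which agent `i` can still propose. -/
def State.remOf (s : State n m) (i : Fin n) : Finset (Fin m) := {j | (i, j) ∈ s.rem}

theorem State.remOf_nonempty {s : State n m} {i : Fin n} (hi : i ∈ s.active) :
    (s.remOf i).Nonempty := by
  obtain ⟨j, hj⟩ := (Finset.mem_filter.1 hi).2.2
  exact ⟨j, by simpa [State.remOf] using hj⟩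

/-- The resource to which the active agent `i` proposes next: its best remaining one. -/
def State.next (P : PublicData n m) (τ : TieBreak n m) (s : State n m) (i : Fin n)
    (hi : i ∈ s.active) : Fin m :=
  ((s.remOf i).exists_max_image (agentKey P τ i) (State.remOf_nonempty hi)).choose

theorem State.next_mem (P : PublicData n m) (τ : TieBreak n m) (s : State n m) (i : Fin n)
    (hi : i ∈ s.active) : (i, s.next P τ i hi) ∈ s.rem := by
  have h := ((s.remOf i).exists_max_image (agentKey P τ i)
    (State.remOf_nonempty hi)).choose_spec.1
  exact (Finset.mem_filter.1 h).2

open Classical in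
/-- The active agent `i` proposes to its next resource `j`. If `j` has no mate or prefers `i` to
its mate, then `j` drops its mate (if any) and is tentatively matched to `i`. -/
def State.step (P : PublicData n m) (γ : ℝ) (τ : TieBreak n m) (s : State n m) (i : Fin n)
    (hi : i ∈ s.active) : State n m where
  M :=
    if ∀ k, (k, s.next P τ i hi) ∈ s.M →
        resourceKey P γ τ (s.next P τ i hi) k < resourceKey P γ τ (s.next P τ i hi) i then
      insert (i, s.next P τ i hi) {e ∈ s.M | e.2 ≠ s.next P τ i hi}
    else s.M
  rem := s.rem.erase (i, s.next P τ i hi)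

/-- An arbitrary rule for choosing the next active agent. -/
structure SelectionRule where
  pick : ∀ {n m : ℕ}, PublicData n m → Edges n m → (s : State n m) → s.active.Nonempty → Fin n
  pick_mem : ∀ {n m : ℕ} (P : PublicData n m) (D : Edges n m) (s : State n m)
    (h : s.active.Nonempty), pick P D s h ∈ s.active

instance : Nonempty SelectionRule :=
  ⟨⟨fun _ _ _ h => h.choose, fun _ _ _ h => h.choose_spec⟩⟩

/-- The main loop: while there are active agents, one of them makes its next proposal. -/
def boostLoop (P : PublicData n m) (γ : ℝ) (τ : TieBreak n m) (σ : SelectionRule)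
    (D : Edges n m) (s : State n m) : Edges n m :=
  if h : s.active.Nonempty then
    boostLoop P γ τ σ D (s.step P γ τ (σ.pick P D s h) (σ.pick_mem P D s h))
  else s.M
termination_by s.rem.card
decreasing_by exact Finset.card_erase_lt_of_mem (State.next_mem ..)

theorem State.step_feasible (P : PublicData n m) (γ : ℝ) (τ : TieBreak n m) (D : Edges n m)
    (s : State n m) (i : Fin n) (hi : i ∈ s.active)
    (hM : IsFeasible D s.M) (hr : s.rem ⊆ D) : IsFeasible D (s.step P γ τ i hi).M := by
  have hun : ∀ j, (i, j) ∉ s.M := (Finset.mem_filter.1 hi).2.1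
  have hj : (i, s.next P τ i hi) ∈ D := hr (State.next_mem P τ s i hi)
  unfold State.step
  generalize s.next P τ i hi = j at *
  dsimp only
  split_ifs with h
  · refine ⟨?_, ?_⟩
    · intro e he
      rcases Finset.mem_insert.1 he with rfl | he
      · exact hj
      · exact hM.1 (Finset.mem_filter.1 he).1
    · rintro ⟨a, b⟩ he ⟨c, d⟩ hf hab
      simp only [Finset.mem_insert, Finset.mem_filter, Prod.mk.injEq] at he hf
      rcases he with ⟨rfl, rfl⟩ | ⟨he, heb⟩ <;> rcases hf with ⟨rfl, rfl⟩ | ⟨hf, hfd⟩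
      · rfl
      · rcases hab with rfl | rfl
        · exact absurd hf (hun _)
        · exact absurd rfl hfd
      · rcases hab with rfl | rfl
        · exact absurd he (hun _)
        · exact absurd rfl heb
      · exact hM.2 _ he _ hf hab
  · exact hM

theorem boostLoop_feasible (P : PublicData n m) (γ : ℝ) (τ : TieBreak n m) (σ : SelectionRule)
    (D : Edges n m) (s : State n m) (hM : IsFeasible D s.M) (hr : s.rem ⊆ D) :
    IsFeasible D (boostLoop P γ τ σ D s) := by
  induction s using boostLoop.induct P γ τ σ D with
  | case1 s h ih =>
    rw [boostLoop, dif_pos h]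
    exact ih (State.step_feasible P γ τ D s _ _ hM hr)
      ((Finset.erase_subset _ _).trans hr)
  | case2 s h =>
    rw [boostLoop, dif_neg h]
    exact hM

/-- The mechanism with confidence parameter `γ`: deferred acceptance with boosted offers, starting
from the empty matching with all declared edges still to be proposed. -/
def boost (γ : ℝ) (τ : TieBreakRule) (σ : SelectionRule) : DetMechanism where
  out P D := boostLoop P γ (τ _ _ P) σ D ⟨∅, D⟩
  feasible P D := boostLoop_feasible P γ (τ _ _ P) σ D ⟨∅, D⟩
    ⟨by simp, by simp [IsMatching]⟩ (Finset.Subset.refl D)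

/-! ### The randomized mechanism -/

/-- The boost parameter `δ(γ) = √(2(γ+1)) - 1`. -/
def delta (γ : ℝ) : ℝ := √(2 * (γ + 1)) - 1

/-- The probability `p = 2 / (δ(γ) + 1)`. -/
def boostProb (γ : ℝ) : ℝ := 2 / (delta γ + 1)

theorem boostProb_nonneg (γ : ℝ) : 0 ≤ boostProb γ := by
  unfold boostProb delta
  have := Real.sqrt_nonneg (2 * (γ + 1))
  exact div_nonneg (by norm_num) (by linarith)

theorem boostProb_le_one {γ : ℝ} (hγ : 1 ≤ γ) : boostProb γ ≤ 1 := by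
  unfold boostProb delta
  have h : (2 : ℝ) ≤ √(2 * (γ + 1)) := Real.le_sqrt_of_sq_le (by linarith)
  rw [sub_add_cancel]
  exact div_le_one_of_le₀ h (by linarith)

/-- Run `boost` with parameter `δ(γ)` with probability `p`, and `trust` with probability
`1 - p`. -/
def boostOrTrust (γ : ℝ) (hγ : 1 ≤ γ) (τ : TieBreakRule) (σ : SelectionRule) :
    RandMechanism where
  prob := Finsupp.single (boost (delta γ) τ σ) (boostProb γ) +
    Finsupp.single trust (1 - boostProb γ)
  prob_nonneg B := by
    classical
    rw [Finsupp.add_apply, Finsupp.single_apply, Finsupp.single_apply]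
    have h0 := boostProb_nonneg γ
    have h1 := boostProb_le_one hγ
    split_ifs <;> linarith
  prob_sum := by
    rw [Finsupp.sum_add_index' (fun _ => rfl) (fun _ _ _ => rfl),
      Finsupp.sum_single_index rfl, Finsupp.sum_single_index rfl]
    ring

open Classical in
/-- The expected approximation guarantee `g(ηhat, γ)`. -/
def guarantee (ηhat γ : ℝ) : ℝ :=
  if ηhat ≤ 1 - √(2 * (γ + 1)) / (2 * γ) then (1 + γ) / (γ * (1 - ηhat))
  else √(2 * (γ + 1))

end

end BMP

/-!
Three independent facts make up the theorem.

*Incentives.* `trust` can only lose an agent its predicted edge when that agent misreports. For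
`boost`, the outcome is a stable matching for the agents' and resources' strict orders `agentKey`
and `resourceKey` (`boost_isStable`), and the blocking lemma of Gale and Sotomayor holds
(`exists_blocking`): if a matching `M'` inside the truthful graph makes some agents better off than
the truthful outcome, then an agent who is *not* better off forms a blocking pair with a resource
against `M'`. If every member of a coalition gained, that agent would be outside the coalition,
so its declarations would be unchanged and the pair would contradict stability of the outcome `M'`
of the manipulated run. The delicate case of the blocking lemma looks at the state in which exactly
one of the better-off agents has yet to make its final proposal (`exists_last_proposal`).

*Value.* Charge each edge of a competing matching to the edge of the stable matching at its agent or
at its resource (`sum_le_of_charging`). Comparison with an optimal matching gives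
`opt ≤ 2 v(B) + (δ - 1) v(pred ∩ D)` for the outcome `B` of `boost δ`, and comparison with
`pred ∩ D` gives `v(pred ∩ D) ≤ (1 + 1/δ) v(B)`. The mixing probability `p = 2/(δ+1)` turns the
first bound into robustness `δ + 1 = √(2(γ+1))`, and since `(δ+1)² = 2(γ+1)` the second one gives
expected value at least `γ/(γ+1) · v(pred ∩ D)`.

*Impossibility.* One instance with two agents and three resources shows that deterministic
strategyproofness and `(1 + 1/γ)`-consistency exclude `ρ`-robustness for every `ρ < 1 + γ`
(`not_isRobust_of_isConsistent`), and `√(2(γ+1)) < 1 + γ` for `γ > 1`.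
-/

namespace BMP

variable {n m : ℕ}

/-! ### Values and utilities -/

theorem IsMatching.subset {M N : Edges n m} (hM : IsMatching M) (h : N ⊆ M) : IsMatching N :=
  fun e he f hf => hM e (h he) f (h hf)

theorem IsMatching.agent_unique {M : Edges n m} (hM : IsMatching M) {i : Fin n} {j j' : Fin m}
    (h : (i, j) ∈ M) (h' : (i, j') ∈ M) : j = j' :=
  congrArg Prod.snd (hM _ h _ h' (Or.inl rfl))

theorem IsMatching.resource_unique {M : Edges n m} (hM : IsMatching M) {i i' : Fin n} {j : Fin m}
    (h : (i, j) ∈ M) (h' : (i', j) ∈ M) : i = i' :=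
  congrArg Prod.fst (hM _ h _ h' (Or.inr rfl))

theorem PublicData.value_nonneg (P : PublicData n m) (M : Edges n m) : 0 ≤ P.value M :=
  Finset.sum_nonneg fun _ _ => (P.v_pos _ _).le

theorem PublicData.value_mono (P : PublicData n m) {M N : Edges n m} (h : M ⊆ N) :
    P.value M ≤ P.value N :=
  Finset.sum_le_sum_of_subset_of_nonneg h fun _ _ _ => (P.v_pos _ _).le

theorem PublicData.opt_nonneg (P : PublicData n m) (D : Edges n m) : 0 ≤ P.opt D := by
  obtain ⟨M, hM⟩ := feasibleSet_nonempty D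
  exact (P.value_nonneg M).trans (Finset.le_sup' P.value hM)

theorem PublicData.value_le_opt (P : PublicData n m) {D M : Edges n m} (h : IsFeasible D M) :
    P.value M ≤ P.opt D :=
  Finset.le_sup' P.value (mem_feasibleSet.2 h)

theorem PublicData.opt_le (P : PublicData n m) {D : Edges n m} {c : ℝ}
    (h : ∀ M, IsFeasible D M → P.value M ≤ c) : P.opt D ≤ c :=
  Finset.sup'_le _ _ fun M hM => h M (mem_feasibleSet.1 hM)

theorem PublicData.utility_eq (P : PublicData n m) {E M : Edges n m} (hM : IsMatching M)
    {i : Fin n} {j : Fin m} (h : (i, j) ∈ M) (hE : (i, j) ∈ E) : P.utility E M i = P.v i j := by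
  have : ({e ∈ M ∩ E | e.1 = i} : Edges n m) = {(i, j)} := by
    ext e
    simp only [Finset.mem_filter, Finset.mem_inter, Finset.mem_singleton]
    constructor
    · rintro ⟨⟨he, -⟩, hi⟩
      exact hM _ he _ h (Or.inl hi)
    · rintro rfl
      exact ⟨⟨h, hE⟩, rfl⟩
  simp [utility, value, this]

theorem PublicData.exists_of_utility_pos (P : PublicData n m) {E M : Edges n m} {i : Fin n}
    (h : 0 < P.utility E M i) : ∃ j, (i, j) ∈ M ∧ (i, j) ∈ E := by
  obtain ⟨⟨a, j⟩, he, -⟩ := Finset.exists_ne_zero_of_sum_ne_zero h.ne'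
  simp only [Finset.mem_filter, Finset.mem_inter] at he
  obtain ⟨⟨h1, h2⟩, rfl⟩ := he
  exact ⟨j, h1, h2⟩

theorem PublicData.utility_nonneg (P : PublicData n m) (E M : Edges n m) (i : Fin n) :
    0 ≤ P.utility E M i :=
  P.value_nonneg _

theorem mem_joint {S : Finset (Fin n)} {A B : Edges n m} {i : Fin n} {j : Fin m} :
    (i, j) ∈ joint S A B ↔ (i ∈ S ∧ (i, j) ∈ A) ∨ (i ∉ S ∧ (i, j) ∈ B) := by
  simp [joint, and_comm]

theorem trust_isGroupStrategyproof : trust.IsGroupStrategyproof := by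
  rintro n m P E D D' S ⟨i, hi⟩
  refine ⟨i, hi, P.value_mono ?_⟩
  rintro ⟨a, j⟩ h
  simp only [trust, Finset.mem_filter, Finset.mem_inter, mem_joint] at h ⊢
  obtain ⟨⟨⟨h1, -⟩, h2⟩, rfl⟩ := h
  exact ⟨⟨⟨h1, Or.inl ⟨hi, h2⟩⟩, h2⟩, rfl⟩

/-! ### Stability of deferred acceptance -/

theorem agentKey_injective (P : PublicData n m) (τ : TieBreak n m) (i : Fin n) :
    Function.Injective (agentKey P τ i) := fun a b h => by
  have h' : (P.v i a, τ.agent i a) = (P.v i b, τ.agent i b) := toLex.injective h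
  exact (τ.agent i).injective (congrArg Prod.snd h')

theorem resourceKey_injective (P : PublicData n m) (γ : ℝ) (τ : TieBreak n m) (j : Fin m) :
    Function.Injective (resourceKey P γ τ j) := fun a b h => by
  have h' : (P.offer γ a j, τ.resource j a) = (P.offer γ b j, τ.resource j b) :=
    toLex.injective h
  exact (τ.resource j).injective (congrArg Prod.snd h')

theorem v_le_of_agentKey_le {P : PublicData n m} {τ : TieBreak n m} {i : Fin n} {j j' : Fin m}
    (h : agentKey P τ i j ≤ agentKey P τ i j') : P.v i j ≤ P.v i j' :=
  Prod.Lex.monotone_fst _ _ h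

theorem agentKey_lt_of_v_lt {P : PublicData n m} {τ : TieBreak n m} {i : Fin n} {j j' : Fin m}
    (h : P.v i j < P.v i j') : agentKey P τ i j < agentKey P τ i j' :=
  Prod.Lex.toLex_lt_toLex.2 (Or.inl h)

theorem offer_le_of_resourceKey_le {P : PublicData n m} {γ : ℝ} {τ : TieBreak n m} {j : Fin m}
    {i i' : Fin n} (h : resourceKey P γ τ j i ≤ resourceKey P γ τ j i') :
    P.offer γ i j ≤ P.offer γ i' j :=
  Prod.Lex.monotone_fst _ _ h

/-- Stability of `M` for the declarations `D`, with respect to the orders `agentKey` and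
`resourceKey`: every declared edge is matched at least as well at its agent or at its resource. -/
def IsStable (P : PublicData n m) (γ : ℝ) (τ : TieBreak n m) (D M : Edges n m) : Prop :=
  ∀ i j, (i, j) ∈ D →
    (∃ j', (i, j') ∈ M ∧ agentKey P τ i j ≤ agentKey P τ i j') ∨
    (∃ k, (k, j) ∈ M ∧ resourceKey P γ τ j i ≤ resourceKey P γ τ j k)

/-- The invariants of the main loop. An edge of `D` has been proposed if it is not in `s.rem`:
agents propose in decreasing order, and a resource always holds an agent at least as good as
everybody who has proposed to it. -/
structure State.Inv (P : PublicData n m) (γ : ℝ) (τ : TieBreak n m) (D : Edges n m)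
    (s : State n m) : Prop where
  feasible : IsFeasible D s.M
  rem_subset : s.rem ⊆ D
  disjoint : ∀ e ∈ s.M, e ∉ s.rem
  order : ∀ i j j', (i, j) ∈ s.rem → (i, j') ∈ D → (i, j') ∉ s.rem →
    agentKey P τ i j < agentKey P τ i j'
  held : ∀ i j, (i, j) ∈ D → (i, j) ∉ s.rem →
    ∃ k, (k, j) ∈ s.M ∧ resourceKey P γ τ j i ≤ resourceKey P γ τ j k

theorem State.inv_init (P : PublicData n m) (γ : ℝ) (τ : TieBreak n m) (D : Edges n m) :
    State.Inv P γ τ D ⟨∅, D⟩ where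
  feasible := ⟨by simp, by simp [IsMatching]⟩
  rem_subset := Finset.Subset.refl D
  disjoint := by simp
  order _ _ _ _ h h' := absurd h h'
  held _ _ h h' := absurd h h'

theorem State.agentKey_le_next (P : PublicData n m) (τ : TieBreak n m) (s : State n m)
    {i : Fin n} (hi : i ∈ s.active) {j : Fin m} (hj : (i, j) ∈ s.rem) :
    agentKey P τ i j ≤ agentKey P τ i (s.next P τ i hi) :=
  ((s.remOf i).exists_max_image (agentKey P τ i) (State.remOf_nonempty hi)).choose_spec.2 j
    (by simpa [State.remOf] using hj)

theorem State.step_M_subset (P : PublicData n m) (γ : ℝ) (τ : TieBreak n m) (s : State n m)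
    (i : Fin n) (hi : i ∈ s.active) :
    (s.step P γ τ i hi).M ⊆ insert (i, s.next P τ i hi) s.M := by
  unfold State.step
  dsimp only
  split_ifs
  · exact Finset.insert_subset_insert _ (Finset.filter_subset _ _)
  · exact Finset.subset_insert _ _

/-- A proposal only improves what each resource holds, and the proposed resource holds
somebody at least as good as the proposer. -/
theorem State.step_held (P : PublicData n m) (γ : ℝ) (τ : TieBreak n m) (s : State n m)
    (i : Fin n) (hi : i ∈ s.active) :
    (∀ k j, (k, j) ∈ s.M → ∃ k', (k', j) ∈ (s.step P γ τ i hi).M ∧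
      resourceKey P γ τ j k ≤ resourceKey P γ τ j k') ∧
    ∃ k', (k', s.next P τ i hi) ∈ (s.step P γ τ i hi).M ∧
      resourceKey P γ τ (s.next P τ i hi) i ≤ resourceKey P γ τ (s.next P τ i hi) k' := by
  unfold State.step
  generalize s.next P τ i hi = r
  dsimp only
  split_ifs with h
  · refine ⟨fun k j hk => ?_, i, by simp, le_rfl⟩
    by_cases hj : j = r
    · subst hj
      exact ⟨i, by simp, (h k hk).le⟩
    · exact ⟨k, by simp [hk, hj], le_rfl⟩
  · push Not at h
    exact ⟨fun k j hk => ⟨k, hk, le_rfl⟩, h⟩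

theorem State.Inv.step {P : PublicData n m} {γ : ℝ} {τ : TieBreak n m} {D : Edges n m}
    {s : State n m} (hs : s.Inv P γ τ D) (i : Fin n) (hi : i ∈ s.active) :
    (s.step P γ τ i hi).Inv P γ τ D where
  feasible := State.step_feasible P γ τ D s i hi hs.feasible hs.rem_subset
  rem_subset := (Finset.erase_subset _ _).trans hs.rem_subset
  disjoint e he hr := by
    obtain ⟨hne, hr⟩ := Finset.mem_erase.1 hr
    rcases Finset.mem_insert.1 (State.step_M_subset P γ τ s i hi he) with h | h
    · exact hne h
    · exact hs.disjoint e h hr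
  order a j j' hj hD hj' := by
    obtain ⟨hne, hjs⟩ := Finset.mem_erase.1 hj
    by_cases h : (a, j') ∈ s.rem
    · have heq : (a, j') = (i, s.next P τ i hi) := by
        by_contra hc
        exact hj' (Finset.mem_erase.2 ⟨hc, h⟩)
      obtain ⟨rfl, rfl⟩ := Prod.mk.inj heq
      refine (State.agentKey_le_next P τ s hi hjs).lt_of_ne fun hk => hne ?_
      rw [agentKey_injective P τ a hk]
    · exact hs.order a j j' hjs hD h
  held a j hD hr := by
    obtain ⟨h1, h2⟩ := State.step_held P γ τ s i hi
    by_cases h : (a, j) ∈ s.rem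
    · have heq : (a, j) = (i, s.next P τ i hi) := by
        by_contra hc
        exact hr (Finset.mem_erase.2 ⟨hc, h⟩)
      obtain ⟨rfl, rfl⟩ := Prod.mk.inj heq
      exact h2
    · obtain ⟨k, hk, hle⟩ := hs.held a j hD h
      obtain ⟨k', hk', hle'⟩ := h1 k j hk
      exact ⟨k', hk', hle.trans hle'⟩

theorem boostLoop_subset (P : PublicData n m) (γ : ℝ) (τ : TieBreak n m) (σ : SelectionRule)
    (D : Edges n m) (s : State n m) : boostLoop P γ τ σ D s ⊆ s.M ∪ s.rem := by
  induction s using boostLoop.induct P γ τ σ D with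
  | case1 s h ih =>
    rw [boostLoop, dif_pos h]
    refine ih.trans (Finset.union_subset ?_ ?_)
    · refine (State.step_M_subset ..).trans (Finset.insert_subset ?_ Finset.subset_union_left)
      exact Finset.mem_union_right _ (State.next_mem ..)
    · exact (Finset.erase_subset _ _).trans Finset.subset_union_right
  | case2 s h =>
    rw [boostLoop, dif_neg h]
    exact Finset.subset_union_left

theorem boostLoop_isStable {P : PublicData n m} {γ : ℝ} {τ : TieBreak n m} (σ : SelectionRule)
    {D : Edges n m} (s : State n m) (hs : s.Inv P γ τ D) :
    IsStable P γ τ D (boostLoop P γ τ σ D s) := by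
  induction s using boostLoop.induct P γ τ σ D with
  | case1 s h ih =>
    rw [boostLoop, dif_pos h]
    exact ih (hs.step _ _)
  | case2 s h =>
    rw [boostLoop, dif_neg h]
    intro i j hij
    by_cases hr : (i, j) ∈ s.rem
    · -- An inactive agent with a remaining proposal is matched, by an earlier proposal.
      left
      by_contra! hc
      refine h ⟨i, Finset.mem_filter.2 ⟨Finset.mem_univ _, fun j' hj' => ?_, j, hr⟩⟩
      exact (hc j' hj').not_gt (hs.order i j j' hr (hs.feasible.1 hj') (hs.disjoint _ hj'))
    · exact Or.inr (hs.held i j hij hr)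

theorem boost_isStable (γ : ℝ) (τ : TieBreakRule) (σ : SelectionRule) (P : PublicData n m)
    (D : Edges n m) : IsStable P γ (τ n m P) D ((boost γ τ σ).out P D) :=
  boostLoop_isStable σ _ (State.inv_init P γ _ D)

/-! ### The blocking lemma and group-strategyproofness -/

/-- For a set `F` of edges of the outcome, the run passes through a state in which exactly one
edge of `F` has not been proposed yet. -/
theorem exists_last_proposal {P : PublicData n m} {γ : ℝ} {τ : TieBreak n m} (σ : SelectionRule)
    {D : Edges n m} (F : Edges n m) (s : State n m) (hs : s.Inv P γ τ D)
    (hF : F ⊆ boostLoop P γ τ σ D s) (hne : ∃ e ∈ F, e ∈ s.rem) :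
    ∃ s' : State n m, s'.Inv P γ τ D ∧ boostLoop P γ τ σ D s' = boostLoop P γ τ σ D s ∧
      ∃ e ∈ F, e ∈ s'.rem ∧ ∀ f ∈ F, f ∈ s'.rem → f = e := by
  induction s using boostLoop.induct P γ τ σ D with
  | case1 s h ih =>
    have hstep : boostLoop P γ τ σ D s = boostLoop P γ τ σ D
        (s.step P γ τ (σ.pick P D s h) (σ.pick_mem P D s h)) := by
      rw [boostLoop, dif_pos h]
    by_cases hc : ∃ e ∈ F, e ∈ (s.step P γ τ (σ.pick P D s h) (σ.pick_mem P D s h)).rem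
    · rw [hstep] at hF ⊢
      exact ih (hs.step _ _) hF hc
    · push Not at hc
      have key : ∀ f ∈ F, f ∈ s.rem →
          f = (σ.pick P D s h, s.next P τ (σ.pick P D s h) (σ.pick_mem P D s h)) := by
        intro f hf hr
        by_contra hfe
        exact hc f hf (Finset.mem_erase.2 ⟨hfe, hr⟩)
      obtain ⟨e, he, her⟩ := hne
      exact ⟨s, hs, rfl, e, he, her, fun f hf hr => (key f hf hr).trans (key e he her).symm⟩
  | case2 s h =>
    rw [boostLoop, dif_neg h] at hF
    obtain ⟨e, he, her⟩ := hne
    exact absurd her (hs.disjoint e (hF he))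

/-- Agent `i` is matched in `M'`, and strictly better than in `M`. -/
def Gains (P : PublicData n m) (τ : TieBreak n m) (M M' : Edges n m) (i : Fin n) : Prop :=
  ∃ j, (i, j) ∈ M' ∧ ∀ j', (i, j') ∈ M → agentKey P τ i j' < agentKey P τ i j

/-- The blocking lemma: if some agent gains by replacing the outcome of deferred acceptance for `D`
by another feasible matching `M'`, then there is a blocking pair for `M'` whose agent does not
gain. -/
theorem exists_blocking (P : PublicData n m) (γ : ℝ) (τ : TieBreak n m) (σ : SelectionRule)
    {D M' : Edges n m} (hM' : IsFeasible D M')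
    (hW : ∃ i, Gains P τ (boostLoop P γ τ σ D ⟨∅, D⟩) M' i) :
    ∃ k j, ¬ Gains P τ (boostLoop P γ τ σ D ⟨∅, D⟩) M' k ∧ (k, j) ∈ D ∧
      (∀ j', (k, j') ∈ M' → agentKey P τ k j' < agentKey P τ k j) ∧
      ∃ i, (i, j) ∈ M' ∧ resourceKey P γ τ j i < resourceKey P γ τ j k := by
  classical
  have hinv := State.inv_init P γ τ D
  have hstab := boostLoop_isStable σ _ hinv
  have hM := boostLoop_feasible P γ τ σ D _ hinv.feasible hinv.rem_subset
  have hex := fun F => exists_last_proposal σ (D := D) F _ hinv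
  generalize hMdef : boostLoop P γ τ σ D ⟨∅, D⟩ = M at *
  -- The `M'`-mate of an agent who gains is strictly better than its `M`-mate.
  have gain_lt : ∀ {i j j'}, Gains P τ M M' i → (i, j) ∈ M' → (i, j') ∈ M →
      agentKey P τ i j' < agentKey P τ i j := by
    rintro i j j' ⟨j₀, h₀, hlt⟩ h h'
    rw [hM'.2.agent_unique h h₀]
    exact hlt j' h'
  have not_gain_le : ∀ {i j}, ¬ Gains P τ M M' i → (i, j) ∈ M' →
      ∃ j', (i, j') ∈ M ∧ agentKey P τ i j ≤ agentKey P τ i j' := by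
    intro i j h hj
    by_contra! hc
    exact h ⟨j, hj, hc⟩
  by_cases hcase : ∀ i j, Gains P τ M M' i → (i, j) ∈ M' → ∃ k, Gains P τ M M' k ∧ (k, j) ∈ M
  · -- The gaining agents have the same mates in `M'` as in `M`, so by counting all of them
    -- are matched in `M`.
    have hall : ∀ i, Gains P τ M M' i → ∃ j, (i, j) ∈ M ∧ ∃ k, Gains P τ M M' k ∧ (k, j) ∈ M' := by
      have h0 : ∀ a : {i // Gains P τ M M' i}, ∃ b : {i // Gains P τ M M' i},
          ∃ j, (a.1, j) ∈ M' ∧ (b.1, j) ∈ M := by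
        rintro ⟨i, hi⟩
        obtain ⟨j, hj, -⟩ := id hi
        obtain ⟨k, hk, hkj⟩ := hcase i j hi hj
        exact ⟨⟨k, hk⟩, j, hj, hkj⟩
      choose f hf using h0
      have hinj : Function.Injective f := by
        intro a b hab
        obtain ⟨j, h1, h2⟩ := hf a
        obtain ⟨j', h1', h2'⟩ := hf b
        rw [hab] at h2
        obtain rfl := hM.2.agent_unique h2 h2'
        exact Subtype.ext (hM'.2.resource_unique h1 h1')
      intro i hi
      obtain ⟨a, ha⟩ := Finite.injective_iff_surjective.1 hinj ⟨i, hi⟩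
      obtain ⟨j, h1, h2⟩ := hf a
      rw [ha] at h2
      exact ⟨j, h2, a.1, a.2, h1⟩
    obtain ⟨i₀, hi₀⟩ := hW
    obtain ⟨j₀, hj₀, -⟩ := hall i₀ hi₀
    obtain ⟨s, hs, hsM, ⟨i, j⟩, hiF, hir, huniq⟩ := hex {e ∈ M | Gains P τ M M' e.1}
      (Finset.filter_subset _ _) ⟨(i₀, j₀), Finset.mem_filter.2 ⟨hj₀, hi₀⟩, hM.1 hj₀⟩
    obtain ⟨hiM, hig⟩ := Finset.mem_filter.1 hiF
    dsimp only at hig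
    have hsub : ∀ e ∈ M, e ∈ s.M ∨ e ∈ s.rem := fun e he =>
      Finset.mem_union.1 (boostLoop_subset P γ τ σ D s (hsM ▸ he))
    -- `k` holds `j` in `M'`; it has already moved on to its final, worse mate.
    obtain ⟨j₁, hj₁, k, hkg, hkj⟩ := hall i hig
    obtain rfl := hM.2.agent_unique hiM hj₁
    obtain ⟨r, hr, -⟩ := hall k hkg
    have hki : k ≠ i := by
      rintro rfl
      exact (gain_lt hig hkj hiM).false
    have hkr : (k, r) ∉ s.rem := fun h => hki
      (congrArg Prod.fst (huniq _ (Finset.mem_filter.2 ⟨hr, hkg⟩) h))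
    have hkj' : (k, j) ∉ s.rem := fun h =>
      (hs.order k j r h (hM.1 hr) hkr).not_gt (gain_lt hkg hkj hr)
    -- So `j` holds a better agent `k'`, who will lose `j` to `i`.
    obtain ⟨k', hk'M, hk'⟩ := hs.held k j (hM'.1 hkj) hkj'
    have hk'i : k' ≠ i := by
      rintro rfl
      exact hs.disjoint _ hk'M hir
    have hk'rem : ∀ r', (k', r') ∈ M → (k', r') ∈ s.rem := by
      intro r' hr'
      refine (hsub _ hr').resolve_left fun h => hk'i ?_
      rw [← hs.feasible.2.agent_unique hk'M h] at hr'
      exact hM.2.resource_unique hr' hiM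
    have hk'g : ¬ Gains P τ M M' k' := by
      intro hg
      obtain ⟨r', hr', -⟩ := hall k' hg
      exact hk'i (congrArg Prod.fst
        (huniq _ (Finset.mem_filter.2 ⟨hr', hg⟩) (hk'rem r' hr')))
    refine ⟨k', j, hk'g, hs.feasible.1 hk'M, fun j' hj' => ?_, k, hkj, ?_⟩
    · obtain ⟨r', hr', hle⟩ := not_gain_le hk'g hj'
      exact hle.trans_lt (hs.order k' r' j (hk'rem r' hr') (hs.feasible.1 hk'M)
        (hs.disjoint _ hk'M))
    · refine hk'.lt_of_ne fun h => hk'g ?_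
      rwa [← resourceKey_injective P γ τ j h]
  · push Not at hcase
    obtain ⟨i, j, hig, hij, hno⟩ := hcase
    rcases hstab i j (hM'.1 hij) with ⟨j', hj', hle⟩ | ⟨k, hk, hle⟩
    · exact absurd (gain_lt hig hij hj') hle.not_gt
    · have hkg : ¬ Gains P τ M M' k := fun h => hno k h hk
      have hik : i ≠ k := by
        rintro rfl
        exact hkg hig
      refine ⟨k, j, hkg, hM.1 hk, fun j' hj' => ?_, i, hij,
        hle.lt_of_ne fun h => hik (resourceKey_injective P γ τ j h)⟩
      obtain ⟨r, hr, hle'⟩ := not_gain_le hkg hj'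
      obtain rfl := hM.2.agent_unique hk hr
      refine hle'.lt_of_ne fun h => hik ?_
      obtain rfl := agentKey_injective P τ k h
      exact hM'.2.resource_unique hij hj'

theorem boost_isGroupStrategyproof (γ : ℝ) (τ : TieBreakRule) (σ : SelectionRule) :
    (boost γ τ σ).IsGroupStrategyproof := by
  rintro n m P E D D' S ⟨i₀, hi₀⟩
  by_contra! hlt
  have hfeas := (boost γ τ σ).feasible P (joint S E D)
  have hfeas' := (boost γ τ σ).feasible P (joint S D' D)
  have hstab' := boost_isStable γ τ σ P (joint S D' D)
  set M' := (boost γ τ σ).out P (joint S D' D)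
  -- Utilities are positive after the deviation, so the coalition is matched along true edges.
  have htrue : ∀ i ∈ S, ∃ j, (i, j) ∈ M' ∧ (i, j) ∈ E := fun i hi =>
    P.exists_of_utility_pos ((P.utility_nonneg _ _ _).trans_lt (hlt i hi))
  have hM' : IsFeasible (joint S E D) M' := by
    refine ⟨?_, hfeas'.2⟩
    rintro ⟨i, j⟩ hij
    by_cases hi : i ∈ S
    · obtain ⟨j', hj', hE⟩ := htrue i hi
      obtain rfl := hfeas'.2.agent_unique hij hj'
      exact mem_joint.2 (Or.inl ⟨hi, hE⟩)
    · rcases mem_joint.1 (hfeas'.1 hij) with h | h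
      · exact absurd h.1 hi
      · exact mem_joint.2 (Or.inr h)
  have hgain : ∀ i ∈ S, Gains P (τ n m P) ((boost γ τ σ).out P (joint S E D)) M' i := by
    intro i hi
    obtain ⟨j, hj, hE⟩ := htrue i hi
    refine ⟨j, hj, fun j' hj' => agentKey_lt_of_v_lt ?_⟩
    have hE' : (i, j') ∈ E := by
      rcases mem_joint.1 (hfeas.1 hj') with h | h
      · exact h.2
      · exact absurd hi h.1
    have := hlt i hi
    rwa [P.utility_eq hfeas.2 hj' hE', P.utility_eq hfeas'.2 hj hE] at this
  obtain ⟨k, j, hkg, hkj, hbetter, i, hij, hlt'⟩ :=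
    exists_blocking P γ (τ n m P) σ hM' ⟨i₀, hgain i₀ hi₀⟩
  have hkS : k ∉ S := fun h => hkg (hgain k h)
  have hkD : (k, j) ∈ joint S D' D := by
    rcases mem_joint.1 hkj with h | h
    · exact absurd h.1 hkS
    · exact mem_joint.2 (Or.inr h)
  rcases hstab' k j hkD with ⟨j', hj', hle⟩ | ⟨i', hi', hle⟩
  · exact hle.not_gt (hbetter j' hj')
  · obtain rfl := hfeas'.2.resource_unique hij hi'
    exact hle.not_gt hlt'

/-! ### Value of the stable matching -/

theorem sum_fiber_le {α β : Type*} [Fintype β] [DecidableEq β] (N B : Finset α)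
    (π : α → β) (hπ : ∀ e ∈ N, ∀ f ∈ N, π e = π f → e = f) {w : α → ℝ} (hw : ∀ b, 0 ≤ w b) :
    ∑ e ∈ N, ∑ b ∈ B with π b = π e, w b ≤ ∑ b ∈ B, w b := by
  rw [← Finset.sum_image (f := fun c => ∑ b ∈ B with π b = c, w b) (g := π)
    (fun e he f hf h => hπ e he f hf h), ← Finset.sum_fiberwise B π w]
  exact Finset.sum_le_sum_of_subset_of_nonneg (Finset.subset_univ _)
    fun c _ _ => Finset.sum_nonneg fun b _ => hw b

/-- If each edge of the matching `N` is charged to an edge of `B` at the same agent (at rate `w₁`)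
or at the same resource (at rate `w₂`), then every edge of `B` is charged at most once in each
way. -/
theorem sum_le_of_charging {N B : Edges n m} (hN : IsMatching N) {u w₁ w₂ : Fin n × Fin m → ℝ}
    (h₁ : ∀ b, 0 ≤ w₁ b) (h₂ : ∀ b, 0 ≤ w₂ b)
    (h : ∀ e ∈ N, (∃ b ∈ B, b.1 = e.1 ∧ u e ≤ w₁ b) ∨ (∃ b ∈ B, b.2 = e.2 ∧ u e ≤ w₂ b)) :
    ∑ e ∈ N, u e ≤ ∑ b ∈ B, w₁ b + ∑ b ∈ B, w₂ b := by
  calc ∑ e ∈ N, u e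
      ≤ ∑ e ∈ N, (∑ b ∈ B with b.1 = e.1, w₁ b + ∑ b ∈ B with b.2 = e.2, w₂ b) := by
        refine Finset.sum_le_sum fun e he => ?_
        have n₁ : 0 ≤ ∑ b ∈ B with b.1 = e.1, w₁ b := Finset.sum_nonneg fun b _ => h₁ b
        have n₂ : 0 ≤ ∑ b ∈ B with b.2 = e.2, w₂ b := Finset.sum_nonneg fun b _ => h₂ b
        rcases h e he with ⟨b, hb, hbe, hle⟩ | ⟨b, hb, hbe, hle⟩
        · have := Finset.single_le_sum (f := w₁) (s := {b ∈ B | b.1 = e.1})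
            (fun b _ => h₁ b) (Finset.mem_filter.2 ⟨hb, hbe⟩)
          linarith
        · have := Finset.single_le_sum (f := w₂) (s := {b ∈ B | b.2 = e.2})
            (fun b _ => h₂ b) (Finset.mem_filter.2 ⟨hb, hbe⟩)
          linarith
    _ = ∑ e ∈ N, ∑ b ∈ B with b.1 = e.1, w₁ b + ∑ e ∈ N, ∑ b ∈ B with b.2 = e.2, w₂ b :=
        Finset.sum_add_distrib
    _ ≤ _ := add_le_add
        (sum_fiber_le N B Prod.fst (fun e he f hf hef => hN e he f hf (Or.inl hef)) h₁)
        (sum_fiber_le N B Prod.snd (fun e he f hf hef => hN e he f hf (Or.inr hef)) h₂)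

theorem IsStable.opt_le {P : PublicData n m} {δ : ℝ} (hδ : 1 ≤ δ) {τ : TieBreak n m}
    {D B : Edges n m} (hB : B ⊆ D) (hs : IsStable P δ τ D B) :
    P.opt D ≤ 2 * P.value B + (δ - 1) * P.value (P.pred ∩ D) := by
  refine P.opt_le fun N hN => ?_
  have hv_le : ∀ i j, P.v i j ≤ P.offer δ i j := by
    intro i j
    have := P.v_pos i j
    unfold PublicData.offer
    split_ifs
    · nlinarith
    · exact le_rfl
  have hcharge := sum_le_of_charging (B := B) hN.2 (u := fun e => P.v e.1 e.2)
    (w₁ := fun e => P.v e.1 e.2) (w₂ := fun e => P.offer δ e.1 e.2)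
    (fun b => (P.v_pos _ _).le) (fun b => (P.v_pos _ _).le.trans (hv_le _ _)) (by
      rintro ⟨i, j⟩ he
      rcases hs i j (hN.1 he) with ⟨j', hj', hle⟩ | ⟨k, hk, hle⟩
      · exact Or.inl ⟨(i, j'), hj', rfl, v_le_of_agentKey_le hle⟩
      · exact Or.inr ⟨(k, j), hk, rfl, (hv_le i j).trans (offer_le_of_resourceKey_le hle)⟩)
  have hoffer : ∑ e ∈ B, P.offer δ e.1 e.2 =
      P.value B + (δ - 1) * P.value {e ∈ B | e ∈ P.pred} := by
    unfold PublicData.value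
    rw [Finset.sum_filter, Finset.mul_sum, ← Finset.sum_add_distrib]
    refine Finset.sum_congr rfl fun e _ => ?_
    unfold PublicData.offer
    split_ifs <;> ring
  have hmono : P.value {e ∈ B | e ∈ P.pred} ≤ P.value (P.pred ∩ D) := P.value_mono fun e he => by
    obtain ⟨h1, h2⟩ := Finset.mem_filter.1 he
    exact Finset.mem_inter.2 ⟨h2, hB h1⟩
  have hmul := mul_le_mul_of_nonneg_left hmono (sub_nonneg.2 hδ)
  rw [hoffer] at hcharge
  change P.value N ≤ P.value B + _ at hcharge
  linarith

theorem IsStable.value_pred_le {P : PublicData n m} {δ : ℝ} (hδ : 1 ≤ δ) {τ : TieBreak n m}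
    {D B : Edges n m} (hs : IsStable P δ τ D B) :
    δ * P.value (P.pred ∩ D) ≤ (δ + 1) * P.value B := by
  have hδ0 : 0 < δ := by linarith
  have hcharge := sum_le_of_charging (N := P.pred ∩ D) (B := B)
    (P.pred_matching.subset Finset.inter_subset_left)
    (u := fun e => δ * P.v e.1 e.2) (w₁ := fun e => δ * P.v e.1 e.2) (w₂ := fun e => P.v e.1 e.2)
    (fun b => mul_nonneg hδ0.le (P.v_pos _ _).le) (fun b => (P.v_pos _ _).le) (by
      rintro ⟨i, j⟩ he
      obtain ⟨hp, hD⟩ := Finset.mem_inter.1 he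
      rcases hs i j hD with ⟨j', hj', hle⟩ | ⟨k, hk, hle⟩
      · exact Or.inl ⟨(i, j'), hj', rfl,
          mul_le_mul_of_nonneg_left (v_le_of_agentKey_le hle) hδ0.le⟩
      · by_cases hki : k = i
        · subst hki
          exact Or.inl ⟨(k, j), hk, rfl, le_rfl⟩
        · -- Another agent's edge at `j` is not predicted, so its offer is not boosted.
          have hkp : (k, j) ∉ P.pred := fun h => hki (P.pred_matching.resource_unique h hp)
          have := offer_le_of_resourceKey_le hle
          rw [PublicData.offer, PublicData.offer, if_pos hp, if_neg hkp] at this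
          exact Or.inr ⟨(k, j), hk, rfl, this⟩)
  rw [← Finset.mul_sum, ← Finset.mul_sum] at hcharge
  change δ * P.value (P.pred ∩ D) ≤ δ * P.value B + P.value B at hcharge
  linarith

/-! ### The randomized mechanism -/

theorem boostOrTrust_isUniversallyGroupStrategyproof (γ : ℝ) (hγ : 1 ≤ γ) (τ : TieBreakRule)
    (σ : SelectionRule) : (boostOrTrust γ hγ τ σ).IsUniversallyGroupStrategyproof := by
  classical
  intro B hB
  rcases Finset.mem_union.1 (Finsupp.support_add hB) with h | h
  · rw [Finset.mem_singleton.1 (Finsupp.support_single_subset h)]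
    exact boost_isGroupStrategyproof _ τ σ
  · rw [Finset.mem_singleton.1 (Finsupp.support_single_subset h)]
    exact trust_isGroupStrategyproof

theorem boostOrTrust_performance (γ : ℝ) (hγ : 1 ≤ γ) (τ : TieBreakRule) (σ : SelectionRule)
    (P : PublicData n m) (D : Edges n m) :
    (boostOrTrust γ hγ τ σ).performance n m P D =
      boostProb γ * P.value ((boost (delta γ) τ σ).out P D) +
        (1 - boostProb γ) * P.value (P.pred ∩ D) := by
  classical
  simp only [RandMechanism.performance, boostOrTrust]
  rw [Finsupp.sum_add_index' (fun _ => zero_mul _) (fun _ _ _ => add_mul _ _ _),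
    Finsupp.sum_single_index (zero_mul _), Finsupp.sum_single_index (zero_mul _)]
  rfl

theorem two_le_sqrt {γ : ℝ} (hγ : 1 ≤ γ) : 2 ≤ √(2 * (γ + 1)) :=
  Real.le_sqrt_of_sq_le (by linarith)

theorem one_le_delta {γ : ℝ} (hγ : 1 ≤ γ) : 1 ≤ delta γ := by
  have := two_le_sqrt hγ
  unfold delta
  linarith

theorem boostOrTrust_robust (γ : ℝ) (hγ : 1 ≤ γ) (τ : TieBreakRule) (σ : SelectionRule)
    (P : PublicData n m) (D : Edges n m) :
    P.opt D ≤ √(2 * (γ + 1)) * (boostOrTrust γ hγ τ σ).performance n m P D := by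
  have hR := two_le_sqrt hγ
  have h := (boost_isStable (delta γ) τ σ P D).opt_le (one_le_delta hγ)
    ((boost (delta γ) τ σ).feasible P D).1
  rw [boostOrTrust_performance]
  unfold boostProb
  have hd : delta γ = √(2 * (γ + 1)) - 1 := rfl
  generalize P.value ((boost (delta γ) τ σ).out P D) = b at *
  rw [hd] at h ⊢
  generalize √(2 * (γ + 1)) = R at *
  have hR0 : R ≠ 0 := by linarith
  have : R * (2 / (R - 1 + 1) * b + (1 - 2 / (R - 1 + 1)) * P.value (P.pred ∩ D)) =
      2 * b + (R - 1 - 1) * P.value (P.pred ∩ D) := by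
    rw [sub_add_cancel]
    field_simp
    ring
  linarith

theorem boostOrTrust_value_pred_le (γ : ℝ) (hγ : 1 ≤ γ) (τ : TieBreakRule) (σ : SelectionRule)
    (P : PublicData n m) (D : Edges n m) :
    γ * P.value (P.pred ∩ D) ≤ (γ + 1) * (boostOrTrust γ hγ τ σ).performance n m P D := by
  have hR := two_le_sqrt hγ
  have hsq : √(2 * (γ + 1)) ^ 2 = 2 * (γ + 1) := Real.sq_sqrt (by linarith)
  have h := (boost_isStable (delta γ) τ σ P D).value_pred_le (one_le_delta hγ)
  rw [boostOrTrust_performance]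
  unfold boostProb
  have hd : delta γ = √(2 * (γ + 1)) - 1 := rfl
  generalize P.value ((boost (delta γ) τ σ).out P D) = b at *
  generalize P.value (P.pred ∩ D) = t at *
  rw [hd] at h ⊢
  generalize √(2 * (γ + 1)) = R at *
  have hR0 : R ≠ 0 := by linarith
  rw [sub_add_cancel] at h ⊢
  have hγ' : γ + 1 = R ^ 2 / 2 := by linarith
  have : (γ + 1) * (2 / R * b + (1 - 2 / R) * t) = R * b + (R ^ 2 / 2 - R) * t := by
    rw [hγ']
    field_simp
  rw [this, show γ = R ^ 2 / 2 - 1 by linarith]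
  linarith

theorem PublicData.opt_mul_le_of_error_le (P : PublicData n m) {D : Edges n m} {η : ℝ}
    (h : P.error D ≤ η) : (1 - η) * P.opt D ≤ P.value (P.pred ∩ D) := by
  unfold error at h
  split_ifs at h with h0
  · rw [h0, mul_zero]
    exact P.value_nonneg _
  · have hpos : 0 < P.opt D := lt_of_le_of_ne (P.opt_nonneg D) (Ne.symm h0)
    have : 1 - η ≤ P.value (P.pred ∩ D) / P.opt D := by linarith
    rwa [le_div_iff₀ hpos] at this

theorem boostOrTrust_isApproximate (γ : ℝ) (hγ : 1 ≤ γ) (τ : TieBreakRule) (σ : SelectionRule)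
    {η : ℝ} (hη : 0 ≤ η) :
    IsApproximate η (guarantee η γ) (boostOrTrust γ hγ τ σ).performance := by
  have hR := two_le_sqrt hγ
  have hγ0 : 0 < γ := by linarith
  unfold guarantee
  split_ifs with hc
  · have hη1 : 0 < 1 - η := by
      have : 0 < √(2 * (γ + 1)) / (2 * γ) := div_pos (by linarith) (by linarith)
      linarith
    have hpos : 0 < γ * (1 - η) := mul_pos hγ0 hη1
    refine ⟨?_, fun n m P D hD => ?_⟩
    · rw [one_le_div hpos]
      nlinarith
    · have h1 := P.opt_mul_le_of_error_le hD
      have h2 := boostOrTrust_value_pred_le γ hγ τ σ P D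
      have h3 := mul_le_mul_of_nonneg_left h1 hγ0.le
      rw [div_mul_eq_mul_div, le_div_iff₀ hpos]
      linarith
  · exact ⟨by linarith, fun n m P D _ => boostOrTrust_robust γ hγ τ σ P D⟩

theorem boostOrTrust_isConsistent (γ : ℝ) (hγ : 1 ≤ γ) (τ : TieBreakRule) (σ : SelectionRule) :
    IsConsistent (1 + 1 / γ) (boostOrTrust γ hγ τ σ).performance := by
  have hγ0 : 0 < γ := by linarith
  refine ⟨by have : 0 < 1 / γ := by positivity
             linarith, fun n m P D hD => ?_⟩
  have h := boostOrTrust_value_pred_le γ hγ τ σ P D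
  rw [hD] at h
  rw [show 1 + 1 / γ = (γ + 1) / γ by field_simp, div_mul_eq_mul_div, le_div_iff₀ hγ0]
  linarith

/-! ### Impossibility for deterministic mechanisms -/

/-- Two agents and three resources, with predicted matching `{(0, 0), (1, 1)}`. The edges that
matter are `(0, 0)` of value `1`, `(0, 1)` of value `a`, `(1, 1)` of value `b` and `(1, 2)` of
value `c`; the other two edges are never declared. -/
def hardInstance (a b c : ℝ) (ha : 0 < a) (hb : 0 < b) (hc : 0 < c) : PublicData 2 3 where
  v := ![![1, a, 1], ![1, b, c]]
  v_pos i j := by fin_cases i <;> fin_cases j <;> simp [ha, hb, hc]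
  pred := {(0, 0), (1, 1)}
  pred_matching := by unfold IsMatching; decide

/-- Suppose `a > 1` but `a (1 + 1/γ) < 1 + b`. Consistency on `{(0,0), (0,1), (1,1)}` forbids giving
`(0,1)` to agent `0`, so by strategyproofness agent `0` does not get it on `{(0,1), (1,1)}`
either, and agent `1` gets `(1,1)` there. Robustness on `{(0,1), (1,1), (1,2)}` forces `(0,1)`, so
agent `1`, who gets at most `c < b`, gains by hiding `(1,2)`. -/
theorem not_isRobust_of_isConsistent {B : DetMechanism} (hsp : B.IsStrategyproof) {γ ρ : ℝ}
    (hγ : 1 < γ) (hcons : IsConsistent (1 + 1 / γ) B.performance) (hρ : ρ < 1 + γ) :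
    ¬ IsRobust ρ B.performance := by
  rintro ⟨hρ1, hrob⟩
  have hγ0 : 0 < γ := by linarith
  -- The slack `t` in `b = 1/γ + t` is small enough to keep `ρ b < 1 + 1/γ`.
  obtain ⟨t, ht, htρ⟩ : ∃ t : ℝ, 0 < t ∧ ρ * (1 / γ + t) < 1 + 1 / γ := by
    refine ⟨(1 + γ - ρ) / γ / (2 * ρ), by
      have : 0 < 1 + γ - ρ := by linarith
      positivity, ?_⟩
    have hρ0 : ρ ≠ 0 := by linarith
    have h1 : 1 + 1 / γ - ρ * (1 / γ + (1 + γ - ρ) / γ / (2 * ρ)) = (1 + γ - ρ) / γ / 2 := by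
      field_simp
      ring
    have h2 : 0 < (1 + γ - ρ) / γ / 2 := by
      have : 0 < 1 + γ - ρ := by linarith
      positivity
    linarith
  have hc : 0 < 1 / γ := by positivity
  have hc1 : 1 / γ < 1 := by rw [div_lt_one hγ0]; exact hγ
  set c := 1 / γ
  obtain ⟨a, ha⟩ : ∃ a, a = 1 + t / 2 := ⟨_, rfl⟩
  obtain ⟨b, hb⟩ : ∃ b, b = c + t := ⟨_, rfl⟩
  rw [← hb] at htρ
  let P := hardInstance a b c (by linarith) (by linarith) hc
  have v00 : P.v 0 0 = 1 := rfl
  have v01 : P.v 0 1 = a := rfl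
  have v11 : P.v 1 1 = b := rfl
  have v12 : P.v 1 2 = c := rfl
  let D₀ : Edges 2 3 := {(0, 0), (0, 1), (1, 1)}
  let D₁ : Edges 2 3 := {(0, 1), (1, 1)}
  let D₂ : Edges 2 3 := {(0, 1), (1, 1), (1, 2)}
  have f₀ := B.feasible P D₀
  have f₁ := B.feasible P D₁
  have f₂ := B.feasible P D₂
  have sub_of_mem : ∀ M : Edges 2 3, IsFeasible D₀ M → (0, 1) ∈ M → M = {(0, 1)} := by
    intro M hM h
    refine Finset.eq_singleton_iff_unique_mem.2 ⟨h, fun e he => ?_⟩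
    have := hM.1 he
    simp only [D₀, Finset.mem_insert, Finset.mem_singleton] at this
    rcases this with rfl | rfl | rfl
    · exact hM.2 _ he _ h (Or.inl rfl)
    · rfl
    · exact hM.2 _ he _ h (Or.inr rfl)
  have val01 : P.value {(0, 1)} = a := by simp [PublicData.value, v01]
  have val11 : P.value {(1, 1)} = b := by simp [PublicData.value, v11]
  have val_pred : P.value {(0, 0), (1, 1)} = 1 + b := by
    simp [PublicData.value, v00, v11]
  have hpredD₀ : P.pred ∩ D₀ = {(0, 0), (1, 1)} := by
    change ({(0, 0), (1, 1)} : Edges 2 3) ∩ {(0, 0), (0, 1), (1, 1)} = _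
    decide
  have hopt₀ : P.opt D₀ = 1 + b := by
    apply le_antisymm
    · refine P.opt_le fun M hM => ?_
      by_cases h : ((0, 1) : Fin 2 × Fin 3) ∈ M
      · rw [sub_of_mem M hM h, val01]
        linarith
      · rw [← val_pred]
        refine P.value_mono fun e he => ?_
        have := hM.1 he
        simp only [D₀, Finset.mem_insert, Finset.mem_singleton] at this ⊢
        rcases this with rfl | rfl | rfl
        · exact Or.inl rfl
        · exact absurd he h
        · exact Or.inr rfl
    · rw [← val_pred, ← hpredD₀]
      exact P.value_le_opt
        ⟨Finset.inter_subset_right, P.pred_matching.subset Finset.inter_subset_left⟩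
  have h₀ : ((0, 1) : Fin 2 × Fin 3) ∉ B.out P D₀ := by
    intro h
    have := hcons.2 2 3 P D₀ (by rw [PublicData.IsPerfect, hpredD₀, val_pred, hopt₀])
    rw [DetMechanism.performance, sub_of_mem _ f₀ h, val01, hopt₀, hb, ha] at this
    nlinarith
  have h₁ : ((0, 1) : Fin 2 × Fin 3) ∉ B.out P D₁ := by
    intro h
    have := hsp 2 3 P D₀ D₀ {(0, 1)} 0
    rw [show joint {0} {(0, 1)} D₀ = D₁ by decide, show joint {0} D₀ D₀ = D₀ by decide,
      P.utility_eq f₁.2 h (by decide), v01] at this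
    obtain ⟨j, hj, hjD⟩ := P.exists_of_utility_pos
      (lt_of_lt_of_le (by linarith : (0 : ℝ) < a) this)
    rw [P.utility_eq f₀.2 hj hjD] at this
    simp only [D₀, Finset.mem_insert, Finset.mem_singleton, Prod.mk.injEq] at hjD
    rcases hjD with ⟨-, rfl⟩ | ⟨-, rfl⟩ | ⟨h', -⟩
    · rw [v00] at this
      linarith
    · exact h₀ hj
    · exact absurd h' (by decide)
  have h₁' : ((1, 1) : Fin 2 × Fin 3) ∈ B.out P D₁ := by
    by_contra h
    have hempty : B.out P D₁ = ∅ := Finset.eq_empty_of_forall_notMem fun e he => by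
      have := f₁.1 he
      simp only [D₁, Finset.mem_insert, Finset.mem_singleton] at this
      rcases this with rfl | rfl
      · exact h₁ he
      · exact h he
    have h2 := hrob 2 3 P D₁
    have h3 : P.value {(0, 1)} ≤ P.opt D₁ :=
      P.value_le_opt ⟨by decide, by unfold IsMatching; decide⟩
    simp only [DetMechanism.performance, hempty, PublicData.value, Finset.sum_empty,
      mul_zero] at h2
    rw [val01] at h3
    linarith
  have h₂ : ((0, 1) : Fin 2 × Fin 3) ∈ B.out P D₂ := by
    by_contra h
    have h2 := hrob 2 3 P D₂
    have h3 : P.value {(0, 1), (1, 2)} ≤ P.opt D₂ :=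
      P.value_le_opt ⟨by decide, by unfold IsMatching; decide⟩
    have h4 : P.value {(0, 1), (1, 2)} = a + c := by
      simp [PublicData.value, v01, v12]
    have h5 : P.value (B.out P D₂) ≤ b := by
      by_cases h11 : ((1, 1) : Fin 2 × Fin 3) ∈ B.out P D₂
      · rw [← val11]
        refine P.value_mono fun e he => ?_
        have := f₂.1 he
        simp only [D₂, Finset.mem_insert, Finset.mem_singleton] at this ⊢
        rcases this with rfl | rfl | rfl
        · exact absurd he h
        · rfl
        · exact f₂.2 _ he _ h11 (Or.inl rfl)
      · have h12 : P.value {(1, 2)} = c := by simp [PublicData.value, v12]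
        have : P.value (B.out P D₂) ≤ P.value {(1, 2)} := P.value_mono fun e he => by
          have := f₂.1 he
          simp only [D₂, Finset.mem_insert, Finset.mem_singleton] at this ⊢
          rcases this with rfl | rfl | rfl
          · exact absurd he h
          · exact absurd he h11
          · rfl
        linarith
    have h6 := mul_le_mul_of_nonneg_left h5 (by linarith : (0 : ℝ) ≤ ρ)
    rw [DetMechanism.performance] at h2
    linarith
  have := hsp 2 3 P D₂ D₂ {(1, 1)} 1
  rw [show joint {1} {(1, 1)} D₂ = D₁ by decide, show joint {1} D₂ D₂ = D₂ by decide,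
    P.utility_eq f₁.2 h₁' (by decide), v11] at this
  obtain ⟨j, hj, hjD⟩ := P.exists_of_utility_pos
    (lt_of_lt_of_le (by linarith : (0 : ℝ) < b) this)
  rw [P.utility_eq f₂.2 hj hjD] at this
  simp only [D₂, Finset.mem_insert, Finset.mem_singleton, Prod.mk.injEq] at hjD
  rcases hjD with ⟨h', -⟩ | ⟨-, rfl⟩ | ⟨-, rfl⟩
  · exact absurd h' (by decide)
  · exact absurd (f₂.2.resource_unique h₂ hj) (by decide)
  · rw [v12] at this
    linarith

end BMP

/-- For all tie-breaking and selection rules, the randomized mechanism is universally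
group-strategyproof, has the stated expected approximation guarantee for every error bound,
and the stated expected consistency and robustness; for `γ > 1` no deterministic strategyproof
mechanism has the latter two. -/
theorem theorem6p1 (γ : ℝ) (hγ : 1 ≤ γ) (τ : BMP.TieBreakRule) (σ : BMP.SelectionRule) :
    (BMP.boostOrTrust γ hγ τ σ).IsUniversallyGroupStrategyproof ∧
    (∀ ηhat ∈ Set.Icc (0 : ℝ) 1,
      BMP.IsApproximate ηhat (BMP.guarantee ηhat γ) (BMP.boostOrTrust γ hγ τ σ).performance) ∧
    BMP.IsConsistent (1 + 1 / γ) (BMP.boostOrTrust γ hγ τ σ).performance ∧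
    BMP.IsRobust (√(2 * (γ + 1))) (BMP.boostOrTrust γ hγ τ σ).performance ∧
    (1 < γ → ¬ ∃ B : BMP.DetMechanism, B.IsStrategyproof ∧
      BMP.IsConsistent (1 + 1 / γ) B.performance ∧
      BMP.IsRobust (√(2 * (γ + 1))) B.performance) := by
  refine ⟨BMP.boostOrTrust_isUniversallyGroupStrategyproof γ hγ τ σ,
    fun ηhat hη => BMP.boostOrTrust_isApproximate γ hγ τ σ hη.1,
    BMP.boostOrTrust_isConsistent γ hγ τ σ,
    ⟨by linarith [BMP.two_le_sqrt hγ], fun n m P D => BMP.boostOrTrust_robust γ hγ τ σ P D⟩, ?_⟩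
  rintro hγ1 ⟨B, hsp, hcons, hrob⟩
  refine BMP.not_isRobust_of_isConsistent hsp hγ1 hcons ?_ hrob
  rw [Real.sqrt_lt' (by linarith)]
  nlinarith
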